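/- Inner products are linear in the second argument and all Hilbert spaces are complex. A unitary representation $\pi\colon G\to \mathrm{U}(H)$ of a group $G$ on a Hilbert space $H$ is a homomorphism into the unitary group of $H$. It is a $c_0$-representation if for all $\xi,\eta\in H$ and every $\varepsilon>0$ the set $\{g\in G : |\langle \xi,\pi(g)\eta\rangle|\ge\varepsilon\}$ is finite; it has almost invariant vectors if for every finite $E\subseteq G$ and every $\varepsilon>0$ there is a unit vector $\xi\in H$ with $\|\xi-\pi(g)\xi\|\le\varepsilon$ for all $g\in E$. A countable group has the Haagerup property if it admits a $c_0$-representation with almost invariant vectors on some Hilbert space. For a set $X$, a probability charge on the power set $\mathcal P(X)$ is a map $\mu\colon\mathcal P(X)\to[0,1]$ with $\mu(X)=1$ and $\mu(A\cup B)=\mu(A)+\mu(B)$ whenever $A\cap B=\emptyset$. Integration of bounded functions $X\to\mathbb C$ against $\mu$ is the unique norm-continuous linear functional sending each indicator function $\chi_A$ to $\mu(A)$. Write $\delta_x$ $(x\in X)$ for the standard basis vectors of $\ell^2(X)$, and let $$\mu_\bullet\colon \mathrm{B}(\ell^2(X))\to\mathbb C,\qquad \mu_\bullet(a)=\int\langle\delta_x,a\delta_x\rangle\,\mathrm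 d\mu(x).$$ For a unitary representation $\pi\colon G\to\mathrm U(\ell^2(X))$, the functional $\mu_\bullet$ is $\pi$-invariant if $\mu_\bullet(\pi(g)^*a\,\pi(g))=\mu_\bullet(a)$ for all $g\in G$ and all $a\in\mathrm B(\ell^2(X))$. **Corollary.** A countable group $G$ has the Haagerup property if and only if there exist a set $X$, a probability charge $\mu$ on $\mathcal P(X)$ and a unitary representation $\pi\colon G\to\mathrm U(\ell^2(X))$ such that $\mu_\bullet$ is $\pi$-invariant and, for all $x,y\in X$ and every $\varepsilon>0$, $$\bigl|\{g\in G : |\langle\delta_x,\pi(g)\delta_y\rangle|\ge\varepsilon\}\bigr|<\infty .$$ -/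

import Mathlib

open scoped ENNReal

universe u v

noncomputable section

/-- A probability charge on the power set of `X`: a finitely additive `[0,1]`-valued set function
with total mass one. -/
structure ProbabilityCharge (X : Type*) where
  /-- the value of the charge on a subset -/
  toFun : Set X → ℝ
  mem_Icc : ∀ A, toFun A ∈ Set.Icc (0 : ℝ) 1
  univ_eq_one : toFun Set.univ = 1
  union_eq_add : ∀ A B, A ∩ B = ∅ → toFun (A ∪ B) = toFun A + toFun B

namespace ProbabilityCharge

variable {X : Type*}

/-- The integral of a bounded real-valued function against a charge: the supremum of
`∑ i, c i * μ (A i)` over all simple functions below `f`. Here a simple function is `x ↦ c (p x)`,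
where `p : X → ι` labels the finite partition of `X` into the sets `A i = p ⁻¹' {i}`. Every bounded
function is a uniform limit of simple functions, so on bounded functions this is the unique
norm-continuous linear functional that maps each indicator function to the charge of its set. -/
def realIntegral (μ : ProbabilityCharge X) (f : X → ℝ) : ℝ :=
  sSup {r : ℝ | ∃ (ι : Type) (_ : Fintype ι) (p : X → ι) (c : ι → ℝ),
    (∀ x, c (p x) ≤ f x) ∧ r = ∑ i, c i * μ.toFun (p ⁻¹' {i})}

/-- The integral of a bounded complex-valued function against a charge. -/
def integral (μ : ProbabilityCharge X) (f : X → ℂ) : ℂ :=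
  (μ.realIntegral fun x => (f x).re : ℂ) + (μ.realIntegral fun x => (f x).im : ℂ) * Complex.I

end ProbabilityCharge

/-- The Hilbert space `ℓ²(X)` of square-summable complex functions on `X`. -/
abbrev EllTwo (X : Type*) : Type _ := lp (fun _ : X => ℂ) 2

open Classical in
/-- The standard basis vector `δ_x` of `ℓ²(X)`. -/
def basisVec {X : Type*} (x : X) : EllTwo X := lp.single 2 x (1 : ℂ)

/-- The functional `μ_•` on the bounded operators on `ℓ²(X)`: `a ↦ ∫ ⟨δ_x, a δ_x⟩ dμ(x)`.
The integrand is bounded by `‖a‖`. -/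
def ProbabilityCharge.bullet {X : Type*} (μ : ProbabilityCharge X)
    (a : EllTwo X →L[ℂ] EllTwo X) : ℂ :=
  μ.integral fun x => inner ℂ (basisVec x) (a (basisVec x))

section Representations

variable {G : Type*} [Group G] {H : Type*} [NormedAddCommGroup H] [InnerProductSpace ℂ H]
  [CompleteSpace H]

/-- A functional `φ` on `B(H)` is invariant under a unitary representation `π` if
`φ (π(g)* a π(g)) = φ a` for all `g` and all bounded operators `a`. -/
def IsInvariantUnder (φ : (H →L[ℂ] H) → ℂ) (π : G →* unitary (H →L[ℂ] H)) : Prop :=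
  ∀ (g : G) (a : H →L[ℂ] H),
    φ (star (π g : H →L[ℂ] H) * a * (π g : H →L[ℂ] H)) = φ a

/-- Almost invariant vectors: for every finite `E ⊆ G` and `ε > 0` there is a unit vector moved by
at most `ε` by every element of `E`. -/
def HasAlmostInvariantVectors (π : G →* unitary (H →L[ℂ] H)) : Prop :=
  ∀ (E : Finset G) (ε : ℝ), 0 < ε →
    ∃ x : H, ‖x‖ = 1 ∧ ∀ g ∈ E, ‖x - (π g : H →L[ℂ] H) x‖ ≤ ε

/-- A `c₀`-representation: all its matrix coefficients belong to `c₀(G)`. -/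
def IsCZeroRepresentation (π : G →* unitary (H →L[ℂ] H)) : Prop :=
  ∀ (x y : H) (ε : ℝ), 0 < ε →
    {g : G | ε ≤ ‖(inner ℂ x ((π g : H →L[ℂ] H) y) : ℂ)‖}.Finite

end Representations

/-- The Haagerup property of a (countable) group: there is a `c₀`-representation with almost
invariant vectors on some complex Hilbert space. For a countable group the Hilbert space may be
taken separable, so the property does not depend on the universe `v`. -/
def HaagerupProperty (G : Type u) [Group G] : Prop :=
  ∃ (H : Type v) (_ : NormedAddCommGroup H) (_ : InnerProductSpace ℂ H) (_ : CompleteSpace H)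
    (π : G →* unitary (H →L[ℂ] H)), IsCZeroRepresentation π ∧ HasAlmostInvariantVectors π

end

/-! From representation to charge: since `G` is countable, almost invariant vectors can be arranged
as a sequence of unit vectors `ξ n`, asymptotically invariant under every `g`. Tensoring with the
trivial representation on `ℓ²(ℕ)` makes the vectors `δ_n ⊗ ξ n` orthonormal and keeps the
coefficients in `c₀`. Extend them to a Hilbert basis `X`; a nonprincipal ultrafilter on the sequence
is a charge on `X`, and its functional, a limit of asymptotically invariant vector states, is
invariant (`exists_charge_of_orthonormal_seq`).

From charge to representation: invariance of `μ_•` prevents any bounded functional from separating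
the differences of vector states `ω_{δ_x} - ω_{π(g)δ_x}` from `0`. By Hahn–Banach some finite convex
combination is small in norm, so a diagonal density operator `D` is almost invariant in trace norm
(`exists_almost_invariant_weights`). By the Powers–Størmer inequality (`powers_stormer`) the square
root of `D` is almost invariant in Hilbert–Schmidt norm, that is, as a unit vector for `π ⊗ π̄`.
That representation is `c₀` because one `c₀` factor suffices, and `c₀` can be tested on a total set.
-/

noncomputable section

/-! ### Integration against a finitely additive charge. -/

namespace ProbabilityCharge

variable {X : Type*} (μ : ProbabilityCharge X)

/-- The integral of the simple function `x ↦ c (p x)`. -/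
def simpleIntegral {ι : Type*} [Fintype ι] (p : X → ι) (c : ι → ℝ) : ℝ :=
  ∑ i, c i * μ.toFun (p ⁻¹' {i})

lemma toFun_nonneg (A : Set X) : 0 ≤ μ.toFun A := (μ.mem_Icc A).1

lemma toFun_empty : μ.toFun ∅ = 0 := by
  have := μ.union_eq_add ∅ ∅ (by simp)
  simp at this
  exact this

lemma toFun_compl (A : Set X) : μ.toFun Aᶜ = 1 - μ.toFun A := by
  have := μ.union_eq_add A Aᶜ (by simp)
  rw [Set.union_compl_self, μ.univ_eq_one] at this
  linarith

lemma toFun_eq_sum_inter {ι : Type*} [Fintype ι] (p : X → ι) (A : Set X) :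
    μ.toFun A = ∑ i, μ.toFun (A ∩ p ⁻¹' {i}) := by
  classical
  have key : ∀ t : Finset ι, μ.toFun (A ∩ p ⁻¹' t) = ∑ i ∈ t, μ.toFun (A ∩ p ⁻¹' {i}) := by
    intro t
    induction t using Finset.induction_on with
    | empty => simp [toFun_empty]
    | insert a t ha ih =>
      rw [Finset.sum_insert ha, ← ih, ← μ.union_eq_add]
      · congr 1
        ext x
        simp [and_or_left]
      · ext x
        simp only [Set.mem_inter_iff, Set.mem_preimage, Set.mem_singleton_iff, Finset.mem_coe,
          Set.mem_empty_iff_false, iff_false]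
        rintro ⟨⟨_, h⟩, _, h'⟩
        exact ha (h ▸ h')
  simpa using key Finset.univ

lemma simpleIntegral_eq_sum_left {ι κ : Type*} [Fintype ι] [Fintype κ] (p : X → ι) (q : X → κ)
    (c : ι → ℝ) :
    μ.simpleIntegral p c = ∑ i, ∑ j, c i * μ.toFun (p ⁻¹' {i} ∩ q ⁻¹' {j}) := by
  unfold simpleIntegral
  refine Finset.sum_congr rfl fun i _ => ?_
  rw [μ.toFun_eq_sum_inter q, Finset.mul_sum]

lemma simpleIntegral_eq_sum_right {ι κ : Type*} [Fintype ι] [Fintype κ] (p : X → ι) (q : X → κ)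
    (d : κ → ℝ) :
    μ.simpleIntegral q d = ∑ i, ∑ j, d j * μ.toFun (p ⁻¹' {i} ∩ q ⁻¹' {j}) := by
  rw [μ.simpleIntegral_eq_sum_left q p, Finset.sum_comm]
  simp_rw [Set.inter_comm]

/-- Both integrals are written over the common refinement of the two partitions. Nonempty cells are
compared at one of their points, and empty cells have charge zero. -/
lemma simpleIntegral_mono {ι κ : Type*} [Fintype ι] [Fintype κ] {p : X → ι} {q : X → κ}
    {c : ι → ℝ} {d : κ → ℝ} (h : ∀ x, c (p x) ≤ d (q x)) :
    μ.simpleIntegral p c ≤ μ.simpleIntegral q d := by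
  rw [μ.simpleIntegral_eq_sum_left p q, μ.simpleIntegral_eq_sum_right p q]
  refine Finset.sum_le_sum fun i _ => Finset.sum_le_sum fun j _ => ?_
  rcases (p ⁻¹' {i} ∩ q ⁻¹' {j}).eq_empty_or_nonempty with he | ⟨x, hx, hy⟩
  · simp [he, toFun_empty]
  · obtain rfl : p x = i := hx
    obtain rfl : q x = j := hy
    exact mul_le_mul_of_nonneg_right (h x) (μ.toFun_nonneg _)

lemma simpleIntegral_prodMk {ι κ : Type*} [Fintype ι] [Fintype κ] (p : X → ι) (q : X → κ)
    (c : ι → ℝ) (d : κ → ℝ) :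
    μ.simpleIntegral (fun x => (p x, q x)) (fun k => c k.1 + d k.2) =
      μ.simpleIntegral p c + μ.simpleIntegral q d := by
  rw [μ.simpleIntegral_eq_sum_left p q, μ.simpleIntegral_eq_sum_right p q, simpleIntegral,
    Fintype.sum_prod_type, ← Finset.sum_add_distrib]
  refine Finset.sum_congr rfl fun i _ => ?_
  rw [← Finset.sum_add_distrib]
  refine Finset.sum_congr rfl fun j _ => ?_
  rw [← add_mul]
  congr 2
  ext x
  simp

lemma simpleIntegral_add_const {ι : Type*} [Fintype ι] (p : X → ι) (c : ι → ℝ) (r : ℝ) :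
    μ.simpleIntegral p (fun i => c i + r) = μ.simpleIntegral p c + r := by
  have h : ∑ i, μ.toFun (p ⁻¹' {i}) = 1 := by
    have := μ.toFun_eq_sum_inter p Set.univ
    simpa [μ.univ_eq_one] using this.symm
  simp [simpleIntegral, add_mul, Finset.sum_add_distrib, ← Finset.mul_sum, h]

lemma simpleIntegral_const (r : ℝ) : μ.simpleIntegral (fun _ => ()) (fun _ => r) = r := by
  simp [simpleIntegral, μ.univ_eq_one]

variable {μ}

lemma realIntegral_le_simpleIntegral {f : X → ℝ} {M : ℝ} (hf : ∀ x, |f x| ≤ M) {κ : Type*}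
    [Fintype κ] {q : X → κ} {d : κ → ℝ} (h : ∀ x, f x ≤ d (q x)) :
    μ.realIntegral f ≤ μ.simpleIntegral q d := by
  -- The constant `-M` lies below `f`, so the supremum is over a nonempty set.
  refine csSup_le ⟨_, Unit, inferInstance, fun _ => (), fun _ => -M,
    fun x => neg_le_of_abs_le (hf x), rfl⟩ ?_
  rintro _ ⟨ι, _, p, c, hc, rfl⟩
  exact μ.simpleIntegral_mono fun x => (hc x).trans (h x)

lemma simpleIntegral_le_realIntegral {f : X → ℝ} {M : ℝ} (hf : ∀ x, |f x| ≤ M) {ι : Type}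
    [Fintype ι] {p : X → ι} {c : ι → ℝ} (h : ∀ x, c (p x) ≤ f x) :
    μ.simpleIntegral p c ≤ μ.realIntegral f := by
  refine le_csSup ⟨M, ?_⟩ ⟨ι, inferInstance, p, c, h, rfl⟩
  rintro _ ⟨κ, _, q, d, hd, rfl⟩
  rw [← μ.simpleIntegral_const M]
  exact μ.simpleIntegral_mono fun x => (hd x).trans (le_of_abs_le (hf x))

/-- Round `f` down to a multiple of `ε`; boundedness leaves finitely many values. -/
lemma exists_simple_approx {f : X → ℝ} {M : ℝ} (hf : ∀ x, |f x| ≤ M) {ε : ℝ} (hε : 0 < ε) :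
    ∃ (ι : Type) (_ : Fintype ι) (p : X → ι) (c : ι → ℝ),
      ∀ x, c (p x) ≤ f x ∧ f x ≤ c (p x) + ε := by
  have hmem : ∀ x, ⌊f x / ε⌋ ∈ Finset.Icc ⌊-M / ε⌋ ⌊M / ε⌋ := fun x => by
    rw [Finset.mem_Icc]
    exact ⟨Int.floor_mono (by gcongr; exact neg_le_of_abs_le (hf x)),
      Int.floor_mono (by gcongr; exact le_of_abs_le (hf x))⟩
  refine ⟨Finset.Icc ⌊-M / ε⌋ ⌊M / ε⌋, inferInstance, fun x => ⟨_, hmem x⟩,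
    fun k => ((k : ℤ) : ℝ) * ε, fun x => ⟨?_, ?_⟩⟩
  · exact (le_div_iff₀ hε).1 (Int.floor_le _)
  · have := (div_lt_iff₀ hε).1 (Int.lt_floor_add_one (f x / ε))
    dsimp only
    linarith

variable {f g : X → ℝ} {M N : ℝ}

lemma realIntegral_mono (hf : ∀ x, |f x| ≤ M) (hg : ∀ x, |g x| ≤ N) (h : ∀ x, f x ≤ g x) :
    μ.realIntegral f ≤ μ.realIntegral g := by
  refine csSup_le ⟨_, Unit, inferInstance, fun _ => (), fun _ => -M,
    fun x => neg_le_of_abs_le (hf x), rfl⟩ ?_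
  rintro _ ⟨ι, _, p, c, hc, rfl⟩
  exact simpleIntegral_le_realIntegral hg fun x => (hc x).trans (h x)

lemma realIntegral_const (r : ℝ) : μ.realIntegral (fun _ => r) = r := by
  refine le_antisymm ?_ ?_
  · exact (realIntegral_le_simpleIntegral (fun _ => le_rfl) (q := fun _ => ()) (d := fun _ => r)
      fun _ => le_rfl).trans_eq (μ.simpleIntegral_const r)
  · exact (μ.simpleIntegral_const r).symm.trans_le
      (simpleIntegral_le_realIntegral (fun _ => le_rfl) fun _ => le_rfl)

/-- A supremum from below is only superadditive. Sandwiching `f` and `g` between simple functions at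
distance `ε / 2` gives the other inequality up to `ε`. -/
lemma realIntegral_add (hf : ∀ x, |f x| ≤ M) (hg : ∀ x, |g x| ≤ N) :
    μ.realIntegral (fun x => f x + g x) = μ.realIntegral f + μ.realIntegral g := by
  have hfg : ∀ x, |f x + g x| ≤ M + N := fun x =>
    (abs_add_le _ _).trans (add_le_add (hf x) (hg x))
  refine eq_of_forall_dist_le fun ε hε => ?_
  obtain ⟨ι, _, p, c, hc⟩ := exists_simple_approx hf (half_pos hε)
  obtain ⟨κ, _, q, d, hd⟩ := exists_simple_approx hg (half_pos hε)
  have f1 := simpleIntegral_le_realIntegral (μ := μ) hf (p := p) fun x => (hc x).1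
  have g1 := simpleIntegral_le_realIntegral (μ := μ) hg (p := q) fun x => (hd x).1
  have f2 := realIntegral_le_simpleIntegral (μ := μ) hf (q := p) (d := fun i => c i + ε / 2)
    fun x => (hc x).2
  have g2 := realIntegral_le_simpleIntegral (μ := μ) hg (q := q) (d := fun i => d i + ε / 2)
    fun x => (hd x).2
  have s1 := simpleIntegral_le_realIntegral (μ := μ) hfg (p := fun x => (p x, q x))
    (c := fun k => c k.1 + d k.2) fun x => add_le_add (hc x).1 (hd x).1
  have s2 := realIntegral_le_simpleIntegral (μ := μ) hfg (q := fun x => (p x, q x))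
    (d := fun k => (c k.1 + d k.2) + ε) fun x => by
      have := (hc x).2; have := (hd x).2; dsimp only; linarith
  rw [simpleIntegral_add_const] at f2 g2 s2
  rw [simpleIntegral_prodMk] at s1 s2
  rw [Real.dist_eq, abs_le]
  constructor <;> linarith

lemma realIntegral_neg (hf : ∀ x, |f x| ≤ M) :
    μ.realIntegral (fun x => -f x) = -μ.realIntegral f := by
  have := realIntegral_add (μ := μ) hf (g := fun x => -f x) (N := M) (by simpa using hf)
  simp only [add_neg_cancel, realIntegral_const] at this
  linarith

lemma realIntegral_sub (hf : ∀ x, |f x| ≤ M) (hg : ∀ x, |g x| ≤ N) :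
    μ.realIntegral (fun x => f x - g x) = μ.realIntegral f - μ.realIntegral g := by
  simp only [sub_eq_add_neg]
  rw [realIntegral_add hf (N := N) (by simpa using hg), realIntegral_neg hg]

/-- `f` lies below the two-valued function `ε` on `A`, `M` off `A`, and the complement of `A` is
null. -/
lemma realIntegral_le_of_le_on {A : Set X} (hA : μ.toFun A = 1) (hf : ∀ x, |f x| ≤ M) {ε : ℝ}
    (h : ∀ x ∈ A, f x ≤ ε) : μ.realIntegral f ≤ ε := by
  classical
  refine (realIntegral_le_simpleIntegral hf (q := fun x => decide (x ∈ A))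
    (d := fun b => if b then ε else M) fun x => ?_).trans_eq ?_
  · by_cases hx : x ∈ A
    · simpa [hx] using h x hx
    · simpa [hx] using le_of_abs_le (hf x)
  · have h1 : (fun x => decide (x ∈ A)) ⁻¹' {true} = A := by ext; simp
    have h2 : (fun x => decide (x ∈ A)) ⁻¹' {false} = Aᶜ := by ext; simp
    simp [simpleIntegral, h1, h2, hA, toFun_compl]

lemma realIntegral_eq_of_null_diff (hf : ∀ x, |f x| ≤ M) (hg : ∀ x, |g x| ≤ N)
    (h : ∀ ε > 0, μ.toFun {x | |f x - g x| ≤ ε} = 1) :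
    μ.realIntegral f = μ.realIntegral g := by
  have hfg : ∀ x, |f x - g x| ≤ M + N := fun x =>
    (abs_sub _ _).trans (add_le_add (hf x) (hg x))
  have hgf : ∀ x, |g x - f x| ≤ M + N := fun x => by rw [abs_sub_comm]; exact hfg x
  refine eq_of_forall_dist_le fun ε hε => ?_
  have h1 := realIntegral_le_of_le_on (h ε hε) hfg fun x hx => le_of_abs_le hx
  have h2 := realIntegral_le_of_le_on (h ε hε) hgf fun x hx => by
    rw [Set.mem_ofPred_eq, abs_sub_comm] at hx
    exact le_of_abs_le hx
  rw [realIntegral_sub hf hg] at h1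
  rw [realIntegral_sub hg hf] at h2
  rw [Real.dist_eq, abs_le]
  constructor <;> linarith

/-- The `{0, 1}`-valued charge of an ultrafilter. -/
def ofUltrafilter (U : Ultrafilter X) : ProbabilityCharge X :=
  open Classical in
  { toFun := fun A => if A ∈ U then 1 else 0
    mem_Icc := fun A => by split_ifs <;> simp
    univ_eq_one := if_pos Filter.univ_mem
    union_eq_add := fun A B h => by
      by_cases hA : A ∈ U <;> by_cases hB : B ∈ U <;> simp [hA, hB, Ultrafilter.union_mem_iff]
      have := U.inter_mem hA hB
      rw [h] at this
      exact U.empty_notMem this }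

lemma ofUltrafilter_eq_one {U : Ultrafilter X} {A : Set X} (h : A ∈ U) :
    (ofUltrafilter U).toFun A = 1 := by
  simp [ofUltrafilter, h]

end ProbabilityCharge

open Filter Topology
open scoped TensorProduct

/-! ### Tensor products, conjugates and `c₀`-coefficients of unitary representations. -/

section Construction

variable {G : Type*} [Group G]
variable {H : Type*} [NormedAddCommGroup H] [InnerProductSpace ℂ H]
variable {K : Type*} [NormedAddCommGroup K] [InnerProductSpace ℂ K]

/-- The Hilbert space tensor product. -/
abbrev HilbertTensor (H K : Type*) [NormedAddCommGroup H] [InnerProductSpace ℂ H]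
    [NormedAddCommGroup K] [InnerProductSpace ℂ K] : Type _ :=
  UniformSpace.Completion (H ⊗[ℂ] K)

/-- The elementary tensor as an element of the Hilbert space tensor product. -/
def hilbertTmul (x : H) (y : K) : HilbertTensor H K := ((x ⊗ₜ[ℂ] y : H ⊗[ℂ] K) : HilbertTensor H K)

lemma inner_hilbertTmul (x x' : H) (y y' : K) :
    inner ℂ (hilbertTmul x y) (hilbertTmul x' y') = inner ℂ x x' * inner ℂ y y' := by
  rw [hilbertTmul, hilbertTmul, UniformSpace.Completion.inner_coe, TensorProduct.inner_tmul]

lemma norm_hilbertTmul (x : H) (y : K) : ‖hilbertTmul x y‖ = ‖x‖ * ‖y‖ := by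
  rw [hilbertTmul, UniformSpace.Completion.norm_coe, TensorProduct.norm_tmul]

lemma hilbertTmul_sub (x : H) (y y' : K) :
    hilbertTmul x y - hilbertTmul x y' = hilbertTmul x (y - y') := by
  simp only [hilbertTmul, ← UniformSpace.Completion.coe_sub, TensorProduct.tmul_sub]

lemma topologicalClosure_span_hilbertTmul :
    (Submodule.span ℂ (Set.range fun z : H × K => hilbertTmul z.1 z.2)).topologicalClosure = ⊤ := by
  have h1 : (Submodule.span ℂ (Set.range fun z : H × K => hilbertTmul z.1 z.2)) =
      LinearMap.range (UniformSpace.Completion.toComplL (𝕜 := ℂ) (E := H ⊗[ℂ] K)).toLinearMap := by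
    rw [← Submodule.map_top, ← TensorProduct.span_tmul_eq_top, Submodule.map_span]
    congr 1
    ext z
    simp [hilbertTmul]
  rw [h1, ← Submodule.dense_iff_topologicalClosure_eq_top]
  exact UniformSpace.Completion.denseRange_coe

lemma isCZero_iff_tendsto {α : Type*} (φ : α → ℂ) :
    (∀ ε : ℝ, 0 < ε → {g | ε ≤ ‖φ g‖}.Finite) ↔ Tendsto φ cofinite (𝓝 0) := by
  rw [Metric.tendsto_nhds]
  simp [Filter.eventually_cofinite]

/-- The uniform bound on `φ` makes the set of good `x` a closed subspace. -/
lemma tendsto_inner_zero_of_span {α : Type*} {l : Filter α} {φ : α → H} {C : ℝ}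
    (hφ : ∀ a, ‖φ a‖ ≤ C) {S : Set H} (hS : (Submodule.span ℂ S).topologicalClosure = ⊤)
    (h : ∀ x ∈ S, Tendsto (fun a => (inner ℂ x (φ a) : ℂ)) l (𝓝 0)) (x : H) :
    Tendsto (fun a => (inner ℂ x (φ a) : ℂ)) l (𝓝 0) := by
  have hspan : ∀ y ∈ Submodule.span ℂ S, Tendsto (fun a => (inner ℂ y (φ a) : ℂ)) l (𝓝 0) := by
    intro y hy
    induction hy using Submodule.span_induction with
    | mem y hy => exact h y hy
    | zero => simpa using tendsto_const_nhds
    | add y z _ _ hy hz => simpa [inner_add_left] using hy.add hz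
    | smul c y _ hy => simpa [inner_smul_left, mul_comm] using hy.const_mul (starRingEnd ℂ c)
  have hx : x ∈ closure (Submodule.span ℂ S : Set H) := by
    rw [← Submodule.topologicalClosure_coe, hS]; trivial
  rw [Metric.tendsto_nhds]
  intro ε hε
  -- `|C| + 1` is a positive bound for `‖φ a‖` whatever `C` is.
  obtain ⟨y, hy, hxy⟩ := Metric.mem_closure_iff.1 hx (ε / (2 * (|C| + 1))) (by positivity)
  filter_upwards [Metric.tendsto_nhds.1 (hspan y hy) (ε / 2) (half_pos hε)] with a ha
  rw [dist_zero_right] at ha ⊢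
  rw [dist_eq_norm] at hxy
  have h1 : (inner ℂ x (φ a) : ℂ) = inner ℂ (x - y) (φ a) + inner ℂ y (φ a) := by
    rw [inner_sub_left]; ring
  have h2 : ‖(inner ℂ (x - y) (φ a) : ℂ)‖ ≤ ε / 2 := by
    refine (norm_inner_le_norm _ _).trans ?_
    have h3 : ‖φ a‖ ≤ |C| + 1 := by linarith [hφ a, le_abs_self C]
    calc ‖x - y‖ * ‖φ a‖ ≤ (ε / (2 * (|C| + 1))) * (|C| + 1) := by gcongr
      _ = ε / 2 := by field_simp
  rw [h1]
  linarith [norm_add_le (inner ℂ (x - y) (φ a) : ℂ) (inner ℂ y (φ a))]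

variable [CompleteSpace H] [CompleteSpace K]

/-- An isometric representation of a group on a Hilbert space, as a unitary representation. -/
def unitaryRepOfIsometric (M : G →* (H →L[ℂ] H)) (hM : ∀ g x, ‖M g x‖ = ‖x‖) :
    G →* unitary (H →L[ℂ] H) :=
  M.codRestrict (unitary (H →L[ℂ] H)) fun g =>
    -- An isometry is unitary once it is invertible, and `M g` has inverse `M g⁻¹`.
    ((Group.isUnit g).map M).mem_unitary_of_star_mul_self
      ((M g).norm_map_iff_adjoint_comp_self.mp (hM g))

@[simp]
lemma coe_unitaryRepOfIsometric (M : G →* (H →L[ℂ] H)) (hM : ∀ g x, ‖M g x‖ = ‖x‖) (g : G) :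
    (unitaryRepOfIsometric M hM g : H →L[ℂ] H) = M g := rfl

lemma unitary_norm_map (π : G →* unitary (H →L[ℂ] H)) (g : G) (x : H) :
    ‖(π g : H →L[ℂ] H) x‖ = ‖x‖ := Unitary.norm_map (π g) x

/-- The tensor product of two unitary representations. -/
def tensorRep (π : G →* unitary (H →L[ℂ] H)) (ρ : G →* unitary (K →L[ℂ] K)) :
    G →* unitary (HilbertTensor H K →L[ℂ] HilbertTensor H K) :=
  unitaryRepOfIsometric
    { toFun := fun g =>
        (TensorProduct.mapL (π g : H →L[ℂ] H) (ρ g : K →L[ℂ] K)).completion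
      map_one' := by
        ext x
        induction x using UniformSpace.Completion.induction_on with
        | hp => exact isClosed_eq (by fun_prop) (by fun_prop)
        | ih x =>
          rw [ContinuousLinearMap.completion_apply_coe]
          simp only [map_one, OneMemClass.coe_one, one_apply_eq_self]
          congr 1
          exact congrArg (fun f => f x) (TensorProduct.mapL_id_id (𝕜 := ℂ) (E := H) (G := K))
      map_mul' := fun g h => by
        ext x
        induction x using UniformSpace.Completion.induction_on with
        | hp => exact isClosed_eq (by fun_prop) (by fun_prop)
        | ih x =>
          rw [mul_apply_eq_comp, ContinuousLinearMap.completion_apply_coe,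
            ContinuousLinearMap.completion_apply_coe, ContinuousLinearMap.completion_apply_coe,
            map_mul, map_mul, Submonoid.coe_mul, Submonoid.coe_mul, TensorProduct.mapL_mul]
          rfl }
    fun g x => by
      change ‖(TensorProduct.mapL (π g : H →L[ℂ] H) (ρ g : K →L[ℂ] K)).completion x‖ = ‖x‖
      induction x using UniformSpace.Completion.induction_on with
      | hp => exact isClosed_eq (by fun_prop) (by fun_prop)
      | ih x =>
        rw [ContinuousLinearMap.completion_apply_coe, UniformSpace.Completion.norm_coe,
          UniformSpace.Completion.norm_coe]
        rw [TensorProduct.mapL_apply]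
        exact TensorProduct.norm_map (Unitary.linearIsometryEquiv (π g)).toLinearIsometry
          (Unitary.linearIsometryEquiv (ρ g)).toLinearIsometry x

lemma tensorRep_tmul (π : G →* unitary (H →L[ℂ] H)) (ρ : G →* unitary (K →L[ℂ] K)) (g : G)
    (x : H) (y : K) :
    (tensorRep π ρ g : HilbertTensor H K →L[ℂ] HilbertTensor H K) (hilbertTmul x y) =
      hilbertTmul ((π g : H →L[ℂ] H) x) ((ρ g : K →L[ℂ] K) y) :=
  ContinuousLinearMap.completion_apply_coe _ _

lemma isCZeroRepresentation_of_span (π : G →* unitary (H →L[ℂ] H)) {S : Set H}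
    (hS : (Submodule.span ℂ S).topologicalClosure = ⊤)
    (h : ∀ x ∈ S, ∀ y ∈ S,
      Tendsto (fun g => (inner ℂ x ((π g : H →L[ℂ] H) y) : ℂ)) cofinite (𝓝 0)) :
    IsCZeroRepresentation π := by
  intro x y
  rw [isCZero_iff_tendsto]
  refine tendsto_inner_zero_of_span (C := ‖y‖) (fun g => (unitary_norm_map π g y).le) hS ?_ x
  intro x hx
  -- Unitarity exchanges the two vectors at the cost of replacing `g` by `g⁻¹`, so the density
  -- argument for one variable also serves the other.
  have key : ∀ y : H, Tendsto (fun g => (inner ℂ x ((π g : H →L[ℂ] H) y) : ℂ)) cofinite (𝓝 0) ↔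
      Tendsto (fun g => (inner ℂ y ((π g⁻¹ : H →L[ℂ] H) x) : ℂ)) cofinite (𝓝 0) := fun y => by
    rw [tendsto_zero_iff_norm_tendsto_zero]
    rw [tendsto_zero_iff_norm_tendsto_zero (f := fun g => (inner ℂ y _ : ℂ))]
    refine iff_of_eq (congrArg (fun f => Tendsto f cofinite (𝓝 0)) (funext fun g => ?_))
    rw [norm_inner_symm, ← Unitary.inner_map_map (π g⁻¹) _ x, ← mul_apply_eq_comp,
      ← Submonoid.coe_mul, ← map_mul]
    simp
  rw [key]
  refine tendsto_inner_zero_of_span (C := ‖x‖) (fun g => (unitary_norm_map π g⁻¹ x).le) hS ?_ y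
  intro y hy
  rw [← key]
  exact h x hx y hy

/-- On elementary tensors a coefficient is a product; the factor from `π` is merely bounded while
the one from `ρ` vanishes at infinity. -/
lemma isCZeroRepresentation_tensorRep (π : G →* unitary (H →L[ℂ] H))
    (ρ : G →* unitary (K →L[ℂ] K)) (hρ : IsCZeroRepresentation ρ) :
    IsCZeroRepresentation (tensorRep π ρ) := by
  refine isCZeroRepresentation_of_span _ topologicalClosure_span_hilbertTmul ?_
  rintro _ ⟨⟨x, y⟩, rfl⟩ _ ⟨⟨x', y'⟩, rfl⟩
  simp only [tensorRep_tmul, inner_hilbertTmul]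
  have h1 := ((isCZero_iff_tendsto _).1 (hρ y y')).norm.const_mul (‖x‖ * ‖x'‖)
  rw [norm_zero, mul_zero] at h1
  refine squeeze_zero_norm (fun g => ?_) h1
  rw [norm_mul]
  gcongr
  refine (norm_inner_le_norm _ _).trans_eq ?_
  rw [unitary_norm_map]

/-- Transport of a unitary representation along an isometric isomorphism of Hilbert spaces. -/
def transportRep (π : G →* unitary (H →L[ℂ] H)) (e : H ≃ₗᵢ[ℂ] K) : G →* unitary (K →L[ℂ] K) :=
  unitaryRepOfIsometric
    { toFun := fun g => (e : H →L[ℂ] K) ∘L (π g : H →L[ℂ] H) ∘L (e.symm : K →L[ℂ] H)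
      map_one' := by ext x; simp
      map_mul' := fun g h => by ext x; simp }
    fun g x => by simp [unitary_norm_map]

lemma transportRep_apply (π : G →* unitary (H →L[ℂ] H)) (e : H ≃ₗᵢ[ℂ] K) (g : G) (x : H) :
    (transportRep π e g : K →L[ℂ] K) (e x) = e ((π g : H →L[ℂ] H) x) := by
  simp [transportRep]

variable {X : Type*}

variable (X) in
/-- The standard Hilbert basis of `ℓ²(X)`. -/
def standardHilbertBasis : HilbertBasis X ℂ (EllTwo X) :=
  HilbertBasis.ofRepr (LinearIsometryEquiv.refl ℂ (EllTwo X))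

lemma coe_standardHilbertBasis : ⇑(standardHilbertBasis X) = basisVec := by
  classical
  funext x
  exact (standardHilbertBasis X).repr_self x

lemma orthonormal_basisVec : Orthonormal ℂ (basisVec : X → EllTwo X) :=
  coe_standardHilbertBasis (X := X) ▸ (standardHilbertBasis X).orthonormal

lemma topologicalClosure_span_basisVec :
    (Submodule.span ℂ (Set.range (basisVec : X → EllTwo X))).topologicalClosure = ⊤ :=
  coe_standardHilbertBasis (X := X) ▸ (standardHilbertBasis X).dense_span

lemma star_basisVec (x : X) : star (basisVec x) = basisVec x := by
  classical
  ext y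
  simp only [basisVec, lp.star_apply, lp.single_apply, Pi.single_apply]
  split_ifs <;> simp

/-- The complex conjugate of a unitary representation on `ℓ²(X)`. -/
def conjRep (π : G →* unitary (EllTwo X →L[ℂ] EllTwo X)) :
    G →* unitary (EllTwo X →L[ℂ] EllTwo X) :=
  unitaryRepOfIsometric
    { toFun := fun g => ((starL ℂ : EllTwo X ≃L⋆[ℂ] EllTwo X) : EllTwo X →L⋆[ℂ] EllTwo X) ∘SL
        ((π g : EllTwo X →L[ℂ] EllTwo X) ∘SL
          ((starL ℂ : EllTwo X ≃L⋆[ℂ] EllTwo X) : EllTwo X →L⋆[ℂ] EllTwo X))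
      map_one' := by ext x; simp
      map_mul' := fun g h => by ext x; simp }
    fun g x => by simp [unitary_norm_map]

lemma conjRep_apply (π : G →* unitary (EllTwo X →L[ℂ] EllTwo X)) (g : G) (v : EllTwo X) :
    (conjRep π g : EllTwo X →L[ℂ] EllTwo X) v =
      star ((π g : EllTwo X →L[ℂ] EllTwo X) (star v)) := rfl

lemma inner_star_star (v w : EllTwo X) :
    (inner ℂ (star v) (star w) : ℂ) = starRingEnd ℂ (inner ℂ v w) := by
  rw [lp.inner_eq_tsum, lp.inner_eq_tsum, Complex.conj_tsum]
  simp [mul_comm]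

/-- Conjugation fixes the standard basis, so it conjugates the matrix entries. -/
lemma inner_basisVec_conjRep (π : G →* unitary (EllTwo X →L[ℂ] EllTwo X)) (g : G) (x y : X) :
    (inner ℂ (basisVec x) ((conjRep π g : EllTwo X →L[ℂ] EllTwo X) (basisVec y)) : ℂ) =
      starRingEnd ℂ (inner ℂ (basisVec x) ((π g : EllTwo X →L[ℂ] EllTwo X) (basisVec y))) := by
  rw [conjRep_apply, star_basisVec, ← inner_star_star, star_basisVec]

lemma isCZeroRepresentation_of_basisVec (π : G →* unitary (EllTwo X →L[ℂ] EllTwo X))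
    (h : ∀ (x y : X) (ε : ℝ), 0 < ε →
          {g : G | ε ≤ ‖(inner ℂ (basisVec x)
            ((π g : EllTwo X →L[ℂ] EllTwo X) (basisVec y)) : ℂ)‖}.Finite) :
    IsCZeroRepresentation π := by
  refine isCZeroRepresentation_of_span _ topologicalClosure_span_basisVec ?_
  rintro _ ⟨x, rfl⟩ _ ⟨y, rfl⟩
  exact (isCZero_iff_tendsto _).1 (h x y)

end Construction

/-! ### The Powers–Størmer inequality in finite rank. -/

section PowersStormer

open InnerProductSpace

variable {H : Type*} [NormedAddCommGroup H] [InnerProductSpace ℂ H]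

/-- The diagonal operator `∑ cᵢ |eᵢ⟩⟨eᵢ|`. -/
def diagOp {ι : Type*} [Fintype ι] (e : ι → H) (c : ι → ℝ) : H →L[ℂ] H :=
  ∑ i, (c i : ℂ) • rankOne ℂ (e i) (e i)

lemma diagOp_apply {ι : Type*} [Fintype ι] (e : ι → H) (c : ι → ℝ) (x : H) :
    diagOp e c x = ∑ i, ((c i : ℂ) * inner ℂ (e i) x) • e i := by
  simp [diagOp, rankOne_apply, mul_smul, Complex.coe_smul]

lemma inner_diagOp_left {ι : Type*} [Fintype ι] (e : ι → H) (c : ι → ℝ) (x y : H) :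
    (inner ℂ (diagOp e c x) y : ℂ) = inner ℂ x (diagOp e c y) := by
  simp only [diagOp_apply, sum_inner, inner_sum, inner_smul_left, inner_smul_right, map_mul,
    Complex.conj_ofReal, inner_conj_symm]
  exact Finset.sum_congr rfl fun i _ => by ring

lemma inner_self_diagOp {ι : Type*} [Fintype ι] (e : ι → H) (c : ι → ℝ) (x : H) :
    (inner ℂ x (diagOp e c x) : ℂ) = ((∑ i, c i * ‖(inner ℂ (e i) x : ℂ)‖ ^ 2 : ℝ) : ℂ) := by
  simp only [diagOp_apply, inner_sum, inner_smul_right, Complex.ofReal_sum, Complex.ofReal_mul,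
    Complex.ofReal_pow]
  refine Finset.sum_congr rfl fun i _ => ?_
  rw [mul_assoc, ← inner_conj_symm x, Complex.mul_conj, Complex.normSq_eq_norm_sq,
    Complex.ofReal_pow]

lemma inner_diagOp_diagOp {ι κ : Type*} [Fintype ι] [Fintype κ] (e : ι → H) (f : κ → H)
    (c : ι → ℝ) (d : κ → ℝ) (x : H) :
    (inner ℂ (diagOp e c x) (diagOp f d x) : ℂ) =
      ∑ i, ∑ j, (c i * d j : ℂ) * (inner ℂ (e i) (f j) * (inner ℂ (f j) x * inner ℂ x (e i))) := by
  simp only [diagOp_apply, sum_inner, inner_sum, inner_smul_left, inner_smul_right, map_mul,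
    Complex.conj_ofReal, inner_conj_symm, Finset.mul_sum]
  rw [Finset.sum_comm]
  exact Finset.sum_congr rfl fun i _ => Finset.sum_congr rfl fun j _ => by ring

lemma diagOp_sq_of_orthonormal {ι : Type*} [Fintype ι] {e : ι → H} (he : Orthonormal ℂ e)
    (c : ι → ℝ) (x : H) :
    ‖diagOp e c x‖ ^ 2 = ∑ i, c i ^ 2 * ‖(inner ℂ (e i) x : ℂ)‖ ^ 2 := by
  have h : (inner ℂ (diagOp e c x) (diagOp e c x) : ℂ) =
      ((∑ i, c i ^ 2 * ‖(inner ℂ (e i) x : ℂ)‖ ^ 2 : ℝ) : ℂ) := by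
    simp only [diagOp_apply]
    rw [he.inner_sum, Complex.ofReal_sum]
    refine Finset.sum_congr rfl fun i _ => ?_
    rw [← Complex.normSq_eq_conj_mul_self, Complex.normSq_eq_norm_sq, norm_mul, mul_pow]
    simp
  rw [← Complex.ofReal_inj, ← h, inner_self_eq_norm_sq_to_K]
  simp

lemma norm_diagOp_le_one {ι : Type*} [Fintype ι] {e : ι → H} (he : Orthonormal ℂ e)
    {c : ι → ℝ} (hc : ∀ i, |c i| ≤ 1) : ‖diagOp e c‖ ≤ 1 := by
  refine ContinuousLinearMap.opNorm_le_bound _ zero_le_one fun x => ?_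
  rw [one_mul]
  refine le_of_sq_le_sq ?_ (norm_nonneg _)
  rw [diagOp_sq_of_orthonormal he]
  refine le_trans (Finset.sum_le_sum fun i _ => ?_) (he.sum_inner_products_le x)
  exact mul_le_of_le_one_left (by positivity) ((sq_le_one_iff_abs_le_one _).2 (hc i))

/-- This is the spectral theorem on `K`, which `D` preserves. The last clause is the completeness
relation of the basis; since `b` lies in `K`, only one argument has to. -/
lemma exists_orthonormal_eigenbasis {D : H →L[ℂ] H} (hD : ∀ x y, inner ℂ (D x) y = inner ℂ x (D y))
    (K : Submodule ℂ H) [FiniteDimensional ℂ K] (hK : ∀ x, D x ∈ K) :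
    ∃ (n : ℕ) (b : Fin n → H) (c : Fin n → ℝ), Orthonormal ℂ b ∧
      (∀ k, D (b k) = (c k : ℂ) • b k) ∧
      ∀ x y : H, y ∈ K → ∑ k, (inner ℂ x (b k) * inner ℂ (b k) y : ℂ) = inner ℂ x y := by
  let T : K →ₗ[ℂ] K := (D.toLinearMap.comp K.subtype).codRestrict K fun x => hK x
  have hT : T.IsSymmetric := fun x y => hD x y
  let b := hT.eigenvectorBasis rfl
  refine ⟨_, fun k => (b k : H), hT.eigenvalues rfl, ?_, fun k => ?_, fun x y hy => ?_⟩
  · exact b.orthonormal.comp_linearIsometry K.subtypeₗᵢ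
  · exact congrArg Subtype.val (hT.apply_eigenvectorBasis rfl k)
  · have h := congrArg Subtype.val (b.sum_repr' ⟨y, hy⟩)
    conv_rhs => rw [show y = ((⟨y, hy⟩ : K) : H) from rfl, ← h]
    rw [Submodule.coe_sum, inner_sum]
    refine Finset.sum_congr rfl fun k _ => ?_
    rw [Submodule.coe_smul, inner_smul_right, mul_comm, Submodule.coe_inner]

/-- The Powers–Størmer inequality for two diagonalized density operators of finite rank with the
same eigenvalues. The trace norm is expressed by duality with the bounded operators. -/
theorem powers_stormer {ι : Type*} [Fintype ι] {e f : ι → H} (he : Orthonormal ℂ e)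
    (hf : Orthonormal ℂ f) {p : ι → ℝ} (hp : ∀ i, 0 ≤ p i) (hp1 : ∑ i, p i = 1) {ε : ℝ}
    (h : ∀ a : H →L[ℂ] H, ‖a‖ ≤ 1 →
      ∑ i, p i * ((inner ℂ (e i) (a (e i)) : ℂ).re - (inner ℂ (f i) (a (f i)) : ℂ).re) ≤ ε) :
    2 - 2 * ∑ i, ∑ j, √(p i) * √(p j) * ‖(inner ℂ (e i) (f j) : ℂ)‖ ^ 2 ≤ ε := by
  set s : ι → ℝ := fun i => √(p i) with hs
  have hs0 : ∀ i, 0 ≤ s i := fun i => Real.sqrt_nonneg _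
  -- `S` and `R` below are the square roots of the two density operators.
  have hs2 : ∀ i, s i ^ 2 = p i := fun i => Real.sq_sqrt (hp i)
  set S := diagOp e s
  set R := diagOp f s
  let K : Submodule ℂ H := Submodule.span ℂ (Set.range e ∪ Set.range f)
  have heK : ∀ i, e i ∈ K := fun i => Submodule.subset_span (Or.inl ⟨i, rfl⟩)
  have hfK : ∀ i, f i ∈ K := fun i => Submodule.subset_span (Or.inr ⟨i, rfl⟩)
  have hfin : FiniteDimensional ℂ K :=
    FiniteDimensional.span_of_finite ℂ ((Set.finite_range e).union (Set.finite_range f))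
  have hSR : ∀ x y, inner ℂ ((S - R) x) y = (inner ℂ x ((S - R) y) : ℂ) := fun x y => by
    simp only [sub_apply, inner_sub_left, inner_sub_right]
    rw [inner_diagOp_left, inner_diagOp_left]
  obtain ⟨n, b, c, hb, hbc, hbK⟩ := exists_orthonormal_eigenbasis hSR K fun x => by
    rw [sub_apply, diagOp_apply, diagOp_apply]
    exact K.sub_mem (K.sum_mem fun i _ => K.smul_mem _ (heK i))
      (K.sum_mem fun i _ => K.smul_mem _ (hfK i))
  have pars : ∀ y ∈ K, ∑ k, ‖(inner ℂ (b k) y : ℂ)‖ ^ 2 = ‖y‖ ^ 2 := fun y hy => by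
    have := hbK y y hy
    rw [inner_self_eq_norm_sq_to_K] at this
    rw [← Complex.ofReal_inj, Complex.ofReal_sum]
    refine Eq.trans (Finset.sum_congr rfl fun k _ => ?_) (this.trans (by simp))
    rw [← inner_conj_symm y, ← Complex.normSq_eq_conj_mul_self, Complex.normSq_eq_norm_sq]
  -- This is `tr(S² T)` computed in the eigenbasis of `T`.
  have trace_diag : ∀ (v : ι → H) (t : Fin n → ℝ), Orthonormal ℂ v →
      ∑ i, p i * (inner ℂ (v i) (diagOp b t (v i)) : ℂ).re = ∑ k, t k * ‖diagOp v s (b k)‖ ^ 2 := by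
    intro v t hv
    simp only [inner_self_diagOp, Complex.ofReal_re, diagOp_sq_of_orthonormal hv, Finset.mul_sum,
      hs2]
    rw [Finset.sum_comm]
    refine Finset.sum_congr rfl fun k _ => Finset.sum_congr rfl fun i _ => ?_
    rw [norm_inner_symm]; ring
  have hnorm : ∀ v : ι → H, Orthonormal ℂ v → (∀ i, v i ∈ K) →
      ∑ k, ‖diagOp v s (b k)‖ ^ 2 = 1 := by
    intro v hv hvK
    simp only [diagOp_sq_of_orthonormal hv, hs2]
    rw [Finset.sum_comm, ← hp1]
    refine Finset.sum_congr rfl fun i _ => ?_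
    rw [← Finset.mul_sum]
    simp_rw [norm_inner_symm (v i)]
    rw [pars _ (hvK i), hv.1 i]
    ring
  have hcross : ∑ k, (inner ℂ (S (b k)) (R (b k)) : ℂ).re =
      ∑ i, ∑ j, s i * s j * ‖(inner ℂ (e i) (f j) : ℂ)‖ ^ 2 := by
    rw [← Complex.re_sum]
    have : ∑ k, (inner ℂ (S (b k)) (R (b k)) : ℂ) =
        ((∑ i, ∑ j, s i * s j * ‖(inner ℂ (e i) (f j) : ℂ)‖ ^ 2 : ℝ) : ℂ) := by
      simp only [S, R, inner_diagOp_diagOp, Complex.ofReal_sum]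
      rw [Finset.sum_comm]
      refine Finset.sum_congr rfl fun i _ => ?_
      rw [Finset.sum_comm]
      refine Finset.sum_congr rfl fun j _ => ?_
      rw [← Finset.mul_sum, ← Finset.mul_sum, hbK _ _ (heK i), ← inner_conj_symm (f j),
        Complex.mul_conj, Complex.normSq_eq_norm_sq]
      simp
    rw [this, Complex.ofReal_re]
  -- `S² - R²` is the symmetrized product of `S - R` and `S + R`, and `b k` is an eigenvector of `S
  -- - R`.
  have hdiff : ∀ k, ‖S (b k)‖ ^ 2 - ‖R (b k)‖ ^ 2 =
      c k * ((inner ℂ (b k) (S (b k)) : ℂ).re + (inner ℂ (b k) (R (b k)) : ℂ).re) := by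
    intro k
    have h1 : (inner ℂ ((S - R) (b k)) (S (b k) + R (b k)) : ℂ).re =
        ‖S (b k)‖ ^ 2 - ‖R (b k)‖ ^ 2 := by
      have hS := inner_self_eq_norm_sq (𝕜 := ℂ) (S (b k))
      have hR := inner_self_eq_norm_sq (𝕜 := ℂ) (R (b k))
      have hc : (inner ℂ (S (b k)) (R (b k)) : ℂ).re = (inner ℂ (R (b k)) (S (b k)) : ℂ).re :=
        inner_re_symm (𝕜 := ℂ) _ _
      simp only [RCLike.re_to_complex] at hS hR
      simp only [sub_apply, inner_sub_left, inner_add_right, Complex.sub_re,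
        Complex.add_re, hS, hR, hc]
      ring
    rw [← h1, hbc, inner_smul_left, Complex.conj_ofReal, Complex.re_ofReal_mul, inner_add_right,
      Complex.add_re]
  have heig : ∀ k, c k = (inner ℂ (b k) (S (b k)) : ℂ).re - (inner ℂ (b k) (R (b k)) : ℂ).re := by
    intro k
    rw [← Complex.sub_re, ← inner_sub_right, ← sub_apply, hbc,
      inner_smul_right, inner_self_eq_norm_sq_to_K, hb.1 k]
    simp
  have hpos : ∀ (v : ι → H) k, 0 ≤ (inner ℂ (b k) (diagOp v s (b k)) : ℂ).re := fun v k => by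
    rw [inner_self_diagOp, Complex.ofReal_re]
    exact Finset.sum_nonneg fun i _ => mul_nonneg (hs0 i) (by positivity)
  have hsq : ∀ k, c k ^ 2 = ‖S (b k)‖ ^ 2 + ‖R (b k)‖ ^ 2 -
      2 * (inner ℂ (S (b k)) (R (b k)) : ℂ).re := by
    intro k
    have h1 := norm_sub_sq (𝕜 := ℂ) (S (b k)) (R (b k))
    rw [← sub_apply, hbc, norm_smul, hb.1 k] at h1
    simp only [RCLike.re_to_complex, Complex.norm_real, Real.norm_eq_abs, mul_one, sq_abs] at h1
    linarith
  -- Positivity of `S` and `R` gives `|c k| ≤ ⟨b k, (S + R) (b k)⟩`.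
  have hle : ∀ k, c k ^ 2 ≤ SignType.sign (c k) * (‖S (b k)‖ ^ 2 - ‖R (b k)‖ ^ 2) := by
    intro k
    rw [hdiff, ← mul_assoc, sign_mul_self]
    have h1 := heig k
    have h2 := hpos e k
    have h3 := hpos f k
    have h4 : |c k| ≤ (inner ℂ (b k) (S (b k)) : ℂ).re + (inner ℂ (b k) (R (b k)) : ℂ).re := by
      rw [abs_le]
      constructor <;> linarith
    rw [← sq_abs, sq]
    exact mul_le_mul_of_nonneg_left h4 (abs_nonneg _)
  -- The test operator is the sign of `S - R`, a contraction.
  have htest := h (diagOp b fun k => SignType.sign (c k)) (norm_diagOp_le_one hb fun k => by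
    rcases lt_trichotomy (c k) 0 with h | h | h <;> simp [h])
  simp only [mul_sub, Finset.sum_sub_distrib] at htest
  rw [trace_diag e _ he, trace_diag f _ hf, ← Finset.sum_sub_distrib] at htest
  simp only [← mul_sub] at htest
  -- The sum of the `c k ^ 2` is the squared Hilbert–Schmidt norm of `S - R`, that is `2 - 2
  -- tr(SR)`.
  refine le_trans (le_of_eq ?_) ((Finset.sum_le_sum fun k _ => hle k).trans htest)
  simp only [hsq, Finset.sum_sub_distrib, Finset.sum_add_distrib, ← Finset.mul_sum]
  rw [hnorm e he heK, hnorm f hf hfK, hcross]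
  ring

end PowersStormer

/-! ### Finite convex combinations and Hahn–Banach separation. -/

section Weights

/-- The convex set of finitely supported probability weights on `X`. -/
def probabilityWeights (X : Type*) : Set (X →₀ ℝ) :=
  {w | (∀ x, 0 ≤ w x) ∧ w.sum (fun _ r => r) = 1}

lemma convex_probabilityWeights (X : Type*) : Convex ℝ (probabilityWeights X) := by
  rintro w ⟨hw0, hw1⟩ w' ⟨hw0', hw1'⟩ a b ha hb hab
  refine ⟨fun x => ?_, ?_⟩
  · simp only [Finsupp.add_apply, Finsupp.smul_apply, smul_eq_mul]
    exact add_nonneg (mul_nonneg ha (hw0 x)) (mul_nonneg hb (hw0' x))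
  · rw [Finsupp.sum_add_index' (fun _ => rfl) fun _ _ _ => rfl,
      Finsupp.sum_smul_index' fun _ => rfl, Finsupp.sum_smul_index' fun _ => rfl]
    simp only [smul_eq_mul]
    rw [← Finsupp.mul_sum, ← Finsupp.mul_sum, hw1, hw1']
    linarith

lemma single_mem_probabilityWeights {X : Type*} (x : X) :
    Finsupp.single x 1 ∈ probabilityWeights X := by
  classical
  refine ⟨fun y => ?_, by simp⟩
  rw [Finsupp.single_apply]
  split_ifs <;> simp

/-- A family in a normed space that is not uniformly separated from `0` by any functional has
convex combinations of arbitrarily small norm. -/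
lemma exists_weights_norm_lt {X V : Type*} [NormedAddCommGroup V] [NormedSpace ℂ V] (T : X → V)
    (h : ∀ (f : StrongDual ℂ V) (u : ℝ), 0 < u → ∃ x, (f (T x)).re < u) {ε : ℝ} (hε : 0 < ε) :
    ∃ w ∈ probabilityWeights X, ‖Finsupp.linearCombination ℝ T w‖ < ε := by
  by_contra! hcon
  let C : Set V := Finsupp.linearCombination ℝ T '' probabilityWeights X
  have hC : Convex ℝ C := (convex_probabilityWeights X).linear_image _
  have h0 : (0 : V) ∉ closure C := fun h0 => by
    obtain ⟨_, ⟨w, hw, rfl⟩, hlt⟩ := Metric.mem_closure_iff.1 h0 ε hε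
    rw [dist_zero_left] at hlt
    exact absurd hlt (hcon w hw).not_gt
  obtain ⟨f, u, hu, hf⟩ :=
    RCLike.geometric_hahn_banach_point_closed (𝕜 := ℂ) hC.closure isClosed_closure h0
  rw [map_zero, map_zero] at hu
  obtain ⟨x, hx⟩ := h f u hu
  refine absurd hx (not_lt.2 (hf (T x) (subset_closure
    ⟨_, single_mem_probabilityWeights x, by simp⟩)).le)

end Weights

/-! ### Vector functionals and the bidual of `B(H)`. -/

section VectorFunctional

variable {H : Type*} [NormedAddCommGroup H] [InnerProductSpace ℂ H]

/-- The functional `a ↦ ⟨x, a y⟩` on the bounded operators. -/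
def vectorFunctional (x y : H) : StrongDual ℂ (H →L[ℂ] H) :=
  innerSL ℂ x ∘L ContinuousLinearMap.apply ℂ H y

@[simp]
lemma vectorFunctional_apply (x y : H) (a : H →L[ℂ] H) :
    vectorFunctional x y a = inner ℂ x (a y) := rfl

lemma norm_vectorFunctional_le (x y : H) : ‖vectorFunctional x y‖ ≤ ‖x‖ * ‖y‖ := by
  refine ContinuousLinearMap.opNorm_le_bound _ (by positivity) fun a => ?_
  refine (norm_inner_le_norm _ _).trans ?_
  rw [mul_assoc, mul_comm ‖y‖]
  gcongr
  exact a.le_opNorm y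

/-- On vector functionals, an element of the bidual of `B(H)` acts like an operator. -/
lemma exists_operator_of_bidual [CompleteSpace H] (f : StrongDual ℂ (StrongDual ℂ (H →L[ℂ] H))) :
    ∃ a : H →L[ℂ] H, ∀ x y, f (vectorFunctional x y) = inner ℂ x (a y) := by
  let B : H →L⋆[ℂ] H →L[ℂ] ℂ := LinearMap.mkContinuous₂
    (LinearMap.mk₂'ₛₗ (starRingEnd ℂ) (RingHom.id ℂ) (fun x y => f (vectorFunctional x y))
      (fun x x' y => by
        rw [← map_add]; congr 1; ext a; simp)
      (fun c x y => by
        rw [← map_smul]; congr 1; ext a; simp [mul_comm])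
      (fun x y y' => by
        rw [← map_add]; congr 1; ext a; simp)
      (fun c x y => by
        rw [RingHom.id_apply, ← map_smul]; congr 1; ext a; simp))
    ‖f‖ fun x y => by
      rw [mul_assoc]
      exact (f.le_opNorm _).trans (by gcongr; exact norm_vectorFunctional_le x y)
  -- The operator attached to a sesquilinear form acts in the first slot; the adjoint moves it to
  -- the second.
  refine ⟨ContinuousLinearMap.adjoint (InnerProductSpace.continuousLinearMapOfBilin B),
    fun x y => ?_⟩
  rw [ContinuousLinearMap.adjoint_inner_right, InnerProductSpace.continuousLinearMapOfBilin_apply]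
  rfl

end VectorFunctional

/-! ### From an invariant charge to almost invariant density operators. -/

section Bullet

variable {X : Type*} (μ : ProbabilityCharge X)

lemma norm_basisVec (x : X) : ‖basisVec x‖ = 1 := orthonormal_basisVec.1 x

lemma abs_re_inner_basisVec_le (a : EllTwo X →L[ℂ] EllTwo X) (x : X) :
    |(inner ℂ (basisVec x) (a (basisVec x)) : ℂ).re| ≤ ‖a‖ := by
  refine (Complex.abs_re_le_norm _).trans ((norm_inner_le_norm _ _).trans ?_)
  simpa [norm_basisVec] using a.le_opNorm (basisVec x)

lemma abs_im_inner_basisVec_le (a : EllTwo X →L[ℂ] EllTwo X) (x : X) :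
    |(inner ℂ (basisVec x) (a (basisVec x)) : ℂ).im| ≤ ‖a‖ := by
  refine (Complex.abs_im_le_norm _).trans ((norm_inner_le_norm _ _).trans ?_)
  simpa [norm_basisVec] using a.le_opNorm (basisVec x)

namespace ProbabilityCharge

lemma bullet_re (a : EllTwo X →L[ℂ] EllTwo X) :
    (μ.bullet a).re =
      μ.realIntegral fun x => (inner ℂ (basisVec x) (a (basisVec x)) : ℂ).re := by
  simp [bullet, integral]

lemma bullet_re_add (a b : EllTwo X →L[ℂ] EllTwo X) :
    (μ.bullet (a + b)).re = (μ.bullet a).re + (μ.bullet b).re := by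
  simp only [bullet_re, add_apply, inner_add_right, Complex.add_re]
  exact realIntegral_add (abs_re_inner_basisVec_le a) (abs_re_inner_basisVec_le b)

lemma bullet_re_sub (a b : EllTwo X →L[ℂ] EllTwo X) :
    (μ.bullet (a - b)).re = (μ.bullet a).re - (μ.bullet b).re := by
  simp only [bullet_re, sub_apply, inner_sub_right, Complex.sub_re]
  exact realIntegral_sub (abs_re_inner_basisVec_le a) (abs_re_inner_basisVec_le b)

lemma bullet_re_zero : (μ.bullet 0).re = 0 := by
  simpa using μ.bullet_re_sub 0 0

lemma bullet_re_sum {ι : Type*} (s : Finset ι) (a : ι → EllTwo X →L[ℂ] EllTwo X) :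
    (μ.bullet (∑ i ∈ s, a i)).re = ∑ i ∈ s, (μ.bullet (a i)).re := by
  classical
  induction s using Finset.induction_on with
  | empty => simp [bullet_re_zero]
  | insert i s hi ih => rw [Finset.sum_insert hi, Finset.sum_insert hi, bullet_re_add, ih]

/-- A mean cannot be smaller than every value. This replaces the charge by a single point of `X`. -/
lemma exists_re_inner_lt {a : EllTwo X →L[ℂ] EllTwo X} {u : ℝ} (h : (μ.bullet a).re < u) :
    ∃ x, (inner ℂ (basisVec x) (a (basisVec x)) : ℂ).re < u := by
  by_contra! hcon
  refine absurd h (not_lt.2 ?_)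
  rw [bullet_re, ← realIntegral_const (μ := μ) u]
  exact realIntegral_mono (fun _ => le_rfl) (abs_re_inner_basisVec_le a) hcon

end ProbabilityCharge

variable {G : Type*} [Group G]

/-- If `μ_•` is invariant, then the diagonal states on `B(ℓ²(X))` with finite support contain
almost invariant ones in the norm of the dual. -/
theorem exists_almost_invariant_weights {μ : ProbabilityCharge X}
    {π : G →* unitary (EllTwo X →L[ℂ] EllTwo X)} (hμ : IsInvariantUnder μ.bullet π)
    (E : Finset G) {ε : ℝ} (hε : 0 < ε) :
    ∃ w ∈ probabilityWeights X, ∀ g ∈ E, ‖∑ x ∈ w.support, (w x : ℂ) •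
      (vectorFunctional (basisVec x) (basisVec x) -
        vectorFunctional ((π g : EllTwo X →L[ℂ] EllTwo X) (basisVec x))
          ((π g : EllTwo X →L[ℂ] EllTwo X) (basisVec x)))‖ < ε := by
  classical
  -- All `g ∈ E` are handled in one product space, so that a single `w` serves them all.
  let T : X → E → StrongDual ℂ (EllTwo X →L[ℂ] EllTwo X) := fun x g =>
    vectorFunctional (basisVec x) (basisVec x) -
        vectorFunctional ((π g : EllTwo X →L[ℂ] EllTwo X) (basisVec x))
          ((π g : EllTwo X →L[ℂ] EllTwo X) (basisVec x))
  have hT : ∀ (f : StrongDual ℂ (E → StrongDual ℂ (EllTwo X →L[ℂ] EllTwo X))) (u : ℝ), 0 < u →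
      ∃ x, (f (T x)).re < u := by
    intro f u hu
    -- Each coordinate of `f` acts on vector functionals as an operator `a g`, to which invariance
    -- of `μ_•` applies.
    choose a ha using fun g : E => exists_operator_of_bidual
      (f ∘L ContinuousLinearMap.single ℂ (fun _ : E => StrongDual ℂ (EllTwo X →L[ℂ] EllTwo X)) g)
    have hb : (μ.bullet (∑ g : E, (a g - star (π g : EllTwo X →L[ℂ] EllTwo X) * a g *
        (π g : EllTwo X →L[ℂ] EllTwo X)))).re = 0 := by
      rw [μ.bullet_re_sum]
      refine Finset.sum_eq_zero fun g _ => ?_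
      rw [μ.bullet_re_sub, hμ, sub_self]
    obtain ⟨x, hx⟩ := μ.exists_re_inner_lt (hb.trans_lt hu)
    refine ⟨x, lt_of_eq_of_lt (congrArg Complex.re ?_) hx⟩
    have hsum : T x = ∑ g, Pi.single g (T x g) := (Finset.univ_sum_single (T x)).symm
    rw [hsum, map_sum, sum_apply, inner_sum]
    refine Finset.sum_congr rfl fun g _ => ?_
    change (f ∘L ContinuousLinearMap.single ℂ
      (fun _ : E => StrongDual ℂ (EllTwo X →L[ℂ] EllTwo X)) g) (T x g) = _
    simp only [T]
    rw [map_sub, ha, ha, sub_apply, inner_sub_right, mul_apply_eq_comp, mul_apply_eq_comp,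
      ContinuousLinearMap.star_eq_adjoint, ContinuousLinearMap.adjoint_inner_right]
  obtain ⟨w, hw, hlt⟩ := exists_weights_norm_lt T hT hε
  refine ⟨w, hw, fun g hg => lt_of_le_of_lt ?_ hlt⟩
  refine le_trans (le_of_eq ?_) (norm_le_pi_norm _ (⟨g, hg⟩ : E))
  simp only [Finsupp.linearCombination_apply, Finsupp.sum, T, Finset.sum_apply, Pi.smul_apply]
  rfl

end Bullet


/-! ### Almost invariant vectors in `π ⊗ π̄`. -/

section OfCharge

variable {X : Type*} {G : Type*} [Group G]

/-- The vector `∑ √(w x) δ_x ⊗ δ_x`, the square root of the density operator of `w`. -/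
def sqrtVector (w : X →₀ ℝ) : HilbertTensor (EllTwo X) (EllTwo X) :=
  ∑ x : w.support, (√(w x) : ℂ) • hilbertTmul (basisVec (x : X)) (basisVec (x : X))

lemma tensorRep_sqrtVector (π : G →* unitary (EllTwo X →L[ℂ] EllTwo X)) (g : G) (w : X →₀ ℝ) :
    (tensorRep π (conjRep π) g : HilbertTensor (EllTwo X) (EllTwo X) →L[ℂ] _) (sqrtVector w) =
      ∑ x : w.support, (√(w x) : ℂ) • hilbertTmul
        ((π g : EllTwo X →L[ℂ] EllTwo X) (basisVec (x : X)))
        ((conjRep π g : EllTwo X →L[ℂ] EllTwo X) (basisVec (x : X))) := by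
  rw [sqrtVector, map_sum]
  refine Finset.sum_congr rfl fun x _ => ?_
  rw [map_smul, tensorRep_tmul]

/-- Each matrix entry meets its conjugate from the second factor. The result is the overlap of
square roots occurring in `powers_stormer`. -/
lemma inner_sqrtVector (π : G →* unitary (EllTwo X →L[ℂ] EllTwo X)) (g : G) (w : X →₀ ℝ) :
    (inner ℂ (sqrtVector w) ((tensorRep π (conjRep π) g :
      HilbertTensor (EllTwo X) (EllTwo X) →L[ℂ] _) (sqrtVector w)) : ℂ) =
      ((∑ x : w.support, ∑ y : w.support, √(w x) * √(w y) *
        ‖(inner ℂ (basisVec (x : X))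
          ((π g : EllTwo X →L[ℂ] EllTwo X) (basisVec (y : X))) : ℂ)‖ ^ 2 : ℝ) : ℂ) := by
  rw [tensorRep_sqrtVector, sqrtVector, sum_inner]
  simp only [inner_sum, Complex.ofReal_sum]
  refine Finset.sum_congr rfl fun x _ => Finset.sum_congr rfl fun y _ => ?_
  rw [inner_smul_left, inner_smul_right, inner_hilbertTmul, inner_basisVec_conjRep,
    Complex.mul_conj, Complex.normSq_eq_norm_sq, Complex.conj_ofReal]
  push_cast
  ring

lemma norm_sqrtVector {w : X →₀ ℝ} (hw : w ∈ probabilityWeights X) : ‖sqrtVector w‖ = 1 := by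
  have h1 : (inner ℂ (sqrtVector w) (sqrtVector w) : ℂ) = 1 := by
    have horth : Orthonormal ℂ fun x : w.support =>
        hilbertTmul (basisVec (x : X)) (basisVec (x : X)) := by
      classical
      have hb := orthonormal_iff_ite.1 (orthonormal_basisVec (X := X))
      refine orthonormal_iff_ite.2 fun x y => ?_
      rw [inner_hilbertTmul, hb]
      by_cases h : x = y
      · simp [h]
      · simp [h, Subtype.coe_injective.ne h]
    rw [sqrtVector, horth.inner_sum]
    have h2 : ∀ x : w.support, starRingEnd ℂ (√(w x) : ℂ) * (√(w x) : ℂ) = (w x : ℂ) := fun x => by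
      rw [Complex.conj_ofReal, ← Complex.ofReal_mul, Real.mul_self_sqrt (hw.1 x)]
    simp only [h2]
    rw [Finset.sum_coe_sort w.support fun x => (w x : ℂ), ← Complex.ofReal_sum]
    exact congrArg Complex.ofReal hw.2
  rw [inner_self_eq_norm_sq_to_K] at h1
  have h3 : ‖sqrtVector w‖ ^ 2 = 1 := Complex.ofReal_injective (by simpa using h1)
  exact (pow_eq_one_iff_of_nonneg (norm_nonneg _) two_ne_zero).1 h3

/-- Powers–Størmer for the basis and its translate by `π g`; the dual norm controls the values at
all contractions. -/
lemma two_sub_le_of_weights (π : G →* unitary (EllTwo X →L[ℂ] EllTwo X)) (g : G) {w : X →₀ ℝ}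
    (hw : w ∈ probabilityWeights X) {ε : ℝ}
    (h : ‖∑ x ∈ w.support, (w x : ℂ) • (vectorFunctional (basisVec x) (basisVec x) -
        vectorFunctional ((π g : EllTwo X →L[ℂ] EllTwo X) (basisVec x))
          ((π g : EllTwo X →L[ℂ] EllTwo X) (basisVec x)))‖ ≤ ε) :
    2 - 2 * ∑ x : w.support, ∑ y : w.support, √(w x) * √(w y) *
        ‖(inner ℂ (basisVec (x : X))
          ((π g : EllTwo X →L[ℂ] EllTwo X) (basisVec (y : X))) : ℂ)‖ ^ 2 ≤ ε := by
  have he : Orthonormal ℂ fun x : w.support => basisVec (x : X) :=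
    orthonormal_basisVec.comp _ Subtype.coe_injective
  refine powers_stormer he
    (f := fun x : w.support => (π g : EllTwo X →L[ℂ] EllTwo X) (basisVec (x : X)))
    (he.comp_linearIsometry (Unitary.linearIsometryEquiv (π g)).toLinearIsometry)
    (p := fun x => w x) (fun x => hw.1 x) ?_ fun a ha => ?_
  · rw [Finset.sum_coe_sort w.support fun x => w x]
    exact hw.2
  · have h1 := (Complex.re_le_norm _).trans (((∑ x ∈ w.support, (w x : ℂ) •
      (vectorFunctional (basisVec x) (basisVec x) -
        vectorFunctional ((π g : EllTwo X →L[ℂ] EllTwo X) (basisVec x))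
          ((π g : EllTwo X →L[ℂ] EllTwo X) (basisVec x)))).le_opNorm a).trans
        ((mul_le_of_le_one_right (norm_nonneg _) ha).trans h))
    refine le_of_eq_of_le ?_ h1
    rw [sum_apply, Complex.re_sum,
      Finset.sum_coe_sort w.support fun x => w x * ((inner ℂ (basisVec x) (a (basisVec x)) : ℂ).re -
        (inner ℂ ((π g : EllTwo X →L[ℂ] EllTwo X) (basisVec x))
          (a ((π g : EllTwo X →L[ℂ] EllTwo X) (basisVec x))) : ℂ).re)]
    refine Finset.sum_congr rfl fun x _ => ?_
    simp

theorem hasAlmostInvariantVectors_of_isInvariantUnder {μ : ProbabilityCharge X}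
    {π : G →* unitary (EllTwo X →L[ℂ] EllTwo X)} (hμ : IsInvariantUnder μ.bullet π) :
    HasAlmostInvariantVectors (tensorRep π (conjRep π)) := by
  intro E ε hε
  -- The tolerance is `ε ^ 2` because Powers–Størmer bounds the squared distance.
  obtain ⟨w, hw, hE⟩ := exists_almost_invariant_weights hμ E (sq_pos_of_pos hε)
  refine ⟨sqrtVector w, norm_sqrtVector hw, fun g hg => ?_⟩
  have h1 := two_sub_le_of_weights π g hw (hE g hg).le
  refine le_of_sq_le_sq ?_ hε.le
  rw [norm_sub_sq (𝕜 := ℂ), unitary_norm_map, norm_sqrtVector hw, inner_sqrtVector,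
    RCLike.re_to_complex, Complex.ofReal_re]
  linarith

end OfCharge

/-! ### From almost invariant vectors to an invariant charge. -/

section ToCharge

variable {G : Type*} [Group G]

/-- Enumerate `G` and let the `n`-th vector be `1 / (n + 1)`-invariant under the elements with index
at most `n`. -/
lemma exists_seq_almost_invariant [Countable G] {H : Type*} [NormedAddCommGroup H]
    [InnerProductSpace ℂ H] [CompleteSpace H] {π : G →* unitary (H →L[ℂ] H)}
    (h : HasAlmostInvariantVectors π) :
    ∃ ξ : ℕ → H, (∀ n, ‖ξ n‖ = 1) ∧
      ∀ g, Tendsto (fun n => ‖ξ n - (π g : H →L[ℂ] H) (ξ n)‖) atTop (𝓝 0) := by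
  classical
  obtain ⟨s, hs⟩ := exists_surjective_nat G
  choose ξ hξ hξ' using fun n : ℕ =>
    h ((Finset.range (n + 1)).image s) (1 / ((n : ℝ) + 1)) Nat.one_div_pos_of_nat
  refine ⟨ξ, hξ, fun g => ?_⟩
  obtain ⟨m, rfl⟩ := hs g
  refine squeeze_zero' (Eventually.of_forall fun _ => norm_nonneg _) ?_
    tendsto_one_div_add_atTop_nhds_zero_nat
  filter_upwards [eventually_ge_atTop m] with n hn
  exact hξ' n _ (Finset.mem_image_of_mem _ (Finset.mem_range.2 (Nat.lt_succ_of_le hn)))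

/-- If the basis vectors are asymptotically invariant along an ultrafilter, then the functional
of its charge is invariant. -/
lemma isInvariantUnder_ofUltrafilter {X : Type*} {U : Ultrafilter X}
    {π : G →* unitary (EllTwo X →L[ℂ] EllTwo X)}
    (h : ∀ g, Tendsto (fun x => ‖basisVec x - (π g : EllTwo X →L[ℂ] EllTwo X) (basisVec x)‖)
      U (𝓝 0)) :
    IsInvariantUnder (ProbabilityCharge.ofUltrafilter U).bullet π := by
  intro g a
  set u := (π g : EllTwo X →L[ℂ] EllTwo X)
  have key : ∀ ε > 0, {x | ‖(inner ℂ (basisVec x) ((star u * a * u) (basisVec x)) : ℂ) -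
      inner ℂ (basisVec x) (a (basisVec x))‖ ≤ ε} ∈ U := by
    intro ε hε
    have h1 := (h g).const_mul (2 * ‖a‖)
    rw [mul_zero] at h1
    filter_upwards [h1.eventually (gt_mem_nhds hε)] with x hx
    refine le_trans ?_ hx.le
    have hu : ‖u (basisVec x)‖ = 1 := (unitary_norm_map π g _).trans (norm_basisVec x)
    -- Changing one vector at a time bounds the difference by `2 * ‖a‖ * ‖δ_x - u δ_x‖`.
    have e1 : (inner ℂ (basisVec x) ((star u * a * u) (basisVec x)) : ℂ) -
        inner ℂ (basisVec x) (a (basisVec x)) =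
        -(inner ℂ (basisVec x - u (basisVec x)) (a (u (basisVec x))) +
          inner ℂ (basisVec x) (a (basisVec x - u (basisVec x)))) := by
      rw [mul_apply_eq_comp, mul_apply_eq_comp, ContinuousLinearMap.star_eq_adjoint,
        ContinuousLinearMap.adjoint_inner_right, inner_sub_left, map_sub, inner_sub_right]
      ring
    rw [e1, norm_neg]
    have e2 : ‖(inner ℂ (basisVec x - u (basisVec x)) (a (u (basisVec x))) : ℂ)‖ ≤
        ‖basisVec x - u (basisVec x)‖ * ‖a‖ := by
      refine (norm_inner_le_norm _ _).trans ?_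
      gcongr
      simpa [hu] using a.le_opNorm (u (basisVec x))
    have e3 : ‖(inner ℂ (basisVec x) (a (basisVec x - u (basisVec x))) : ℂ)‖ ≤
        ‖a‖ * ‖basisVec x - u (basisVec x)‖ := by
      refine (norm_inner_le_norm _ _).trans ?_
      rw [norm_basisVec, one_mul]
      exact a.le_opNorm _
    calc _ ≤ _ := norm_add_le _ _
      _ ≤ _ := add_le_add e2 e3
      _ = _ := by ring
  rw [ProbabilityCharge.bullet, ProbabilityCharge.bullet, ProbabilityCharge.integral,
    ProbabilityCharge.integral]
  congr 2
  · refine ProbabilityCharge.realIntegral_eq_of_null_diff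
      (abs_re_inner_basisVec_le _) (abs_re_inner_basisVec_le _) fun ε hε => ?_
    refine ProbabilityCharge.ofUltrafilter_eq_one (mem_of_superset (key ε hε) fun x hx => ?_)
    rw [Set.mem_ofPred_eq, ← Complex.sub_re]
    exact (Complex.abs_re_le_norm _).trans hx
  · refine congrArg Complex.ofReal (ProbabilityCharge.realIntegral_eq_of_null_diff
      (abs_im_inner_basisVec_le _) (abs_im_inner_basisVec_le _) fun ε hε => ?_)
    refine ProbabilityCharge.ofUltrafilter_eq_one (mem_of_superset (key ε hε) fun x hx => ?_)
    rw [Set.mem_ofPred_eq, ← Complex.sub_im]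
    exact (Complex.abs_im_le_norm _).trans hx

/-- Asymptotically invariant orthonormal vectors of a representation yield an invariant charge for
a unitarily equivalent representation on some `ℓ²(X)`. -/
lemma exists_charge_of_orthonormal_seq {K : Type v} [NormedAddCommGroup K] [InnerProductSpace ℂ K]
    [CompleteSpace K] {σ : G →* unitary (K →L[ℂ] K)} (hσ : IsCZeroRepresentation σ) {e : ℕ → K}
    (he : Orthonormal ℂ e)
    (hinv : ∀ g, Tendsto (fun n => ‖e n - (σ g : K →L[ℂ] K) (e n)‖) atTop (𝓝 0)) :
    ∃ (X : Type v) (μ : ProbabilityCharge X) (π : G →* unitary (EllTwo X →L[ℂ] EllTwo X)),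
      IsInvariantUnder μ.bullet π ∧ IsCZeroRepresentation π := by
  -- `X` is a set of vectors of `K`, which keeps it in the universe of `K`.
  obtain ⟨X, b, hX, hb⟩ := he.toSubtypeRange.exists_hilbertBasis_extension
  let i : ℕ → X := fun n => ⟨e n, hX ⟨n, rfl⟩⟩
  have hbasis : ∀ x : X, basisVec x = b.repr (x : K) := fun x => by
    classical
    have h := b.repr_self x
    rw [hb] at h
    rw [h]
    simp only [basisVec]
    congr 1
    exact Subsingleton.elim _ _
  refine ⟨X, ProbabilityCharge.ofUltrafilter (Ultrafilter.map i (hyperfilter ℕ)),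
    transportRep σ b.repr, isInvariantUnder_ofUltrafilter fun g => ?_, fun x y ε hε => ?_⟩
  · simp only [hbasis, transportRep_apply, ← map_sub, LinearIsometryEquiv.norm_map]
    rw [Ultrafilter.coe_map, tendsto_map'_iff]
    -- The hyperfilter is nonprincipal, so limits along it include limits at infinity.
    exact (hinv g).mono_left (Nat.hyperfilter_le_atTop)
  · convert hσ (b.repr.symm x) (b.repr.symm y) ε hε using 5 with g
    conv_lhs => rw [← b.repr.apply_symm_apply x, ← b.repr.apply_symm_apply y, transportRep_apply,
      LinearIsometryEquiv.inner_map_map]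

end ToCharge

end
theorem corollary6p8 (G : Type u) [Group G] [Countable G] :
    HaagerupProperty.{u, v} G ↔
      ∃ (X : Type v) (μ : ProbabilityCharge X)
        (π : G →* unitary (EllTwo X →L[ℂ] EllTwo X)),
        IsInvariantUnder μ.bullet π ∧
        ∀ (x y : X) (ε : ℝ), 0 < ε →
          {g : G | ε ≤ ‖(inner ℂ (basisVec x)
            ((π g : EllTwo X →L[ℂ] EllTwo X) (basisVec y)) : ℂ)‖}.Finite := by
  constructor
  · rintro ⟨H, _, _, _, π, hπ, hinv⟩
    obtain ⟨ξ, hξ, hξ'⟩ := exists_seq_almost_invariant hinv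
    -- The `ξ n` need not be orthogonal; the first tensor factor makes them so without affecting
    -- invariance, since `G` acts trivially on it.
    have horth : Orthonormal ℂ fun n : ℕ => hilbertTmul (basisVec n) (ξ n) := by
      have hb := orthonormal_iff_ite.1 (orthonormal_basisVec (X := ℕ))
      refine orthonormal_iff_ite.2 fun m n => ?_
      rw [inner_hilbertTmul, hb]
      by_cases h : m = n
      · simp [h, hξ, inner_self_eq_norm_sq_to_K]
      · simp [h]
    obtain ⟨X, μ, ρ, hμ, hρ⟩ := exists_charge_of_orthonormal_seq
      (isCZeroRepresentation_tensorRep (1 : G →* unitary (EllTwo ℕ →L[ℂ] EllTwo ℕ)) π hπ) horth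
      fun g => by
        simpa [tensorRep_tmul, hilbertTmul_sub, norm_hilbertTmul, norm_basisVec] using hξ' g
    exact ⟨X, μ, ρ, hμ, fun x y => hρ _ _⟩
  · rintro ⟨X, μ, π, hμ, hc⟩
    refine ⟨HilbertTensor (EllTwo X) (EllTwo X), inferInstance, inferInstance, inferInstance,
      tensorRep π (conjRep π), isCZeroRepresentation_tensorRep _ _ ?_,
      hasAlmostInvariantVectors_of_isInvariantUnder hμ⟩
    refine isCZeroRepresentation_of_basisVec _ fun x y ε hε => ?_
    simpa only [inner_basisVec_conjRep, RCLike.norm_conj] using hc x y ε hε
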